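/- Let $(G,d)$ be a metric tree, i.e. a nonempty metric space in which any two points are joined by exactly one arc, $d(a,b)$ being the length of the arc between $a$ and $b$ (for example a finite tree network with its path-length distance). There are $n\ge 1$ agents with locations $x=(x_1,\dots,x_n)\in G^n$. For $y\in G$ let $sc(y,x)=\sum_{i} d(y,x_i)^2$, and let $Opt(x)=\inf_{y\in G} sc(y,x)$. A deterministic mechanism is a map $f:G^n\to G$, with $cost(f(x),x_i)=d(f(x),x_i)$; a randomized mechanism $F$ assigns to each profile a probability distribution on $G$, and the costs of agents and $sc$ are extended to distributions by expectation. A mechanism is strategyproof (SP) if no agent can decrease her (expected) distance from the facility by misreporting her location. It is an $\alpha$-approximation (for the sum-of-squared-distances objective) if $sc(F(x),x)\le \alpha\, Opt(x)$ for all $x\in G^n$. A deterministic mechanism $f$ is a boomerang mechanism if $d(f(x'),x_i)-d(f(x),x_i)=d(f(x'),f(x))$ whenever $x'$ is obtained from $x$ by changing agent $i$'s report. For $a\in G$, the subtrees at $a$ are the connected components of $G\setminus\{a\}$. The dictatorial generalized median $f_{i}$ with dictator $i$ and fraction $q\in(1/2,1]$ starts at $x_i$ and, as long as some subtree at the current point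 contains at least $qn$ of the agents, moves into that subtree; $f_i(x)$ is the point where it stops. Mechanism randomized DGM with fraction $q$ puts $y_i=f_i(x)$, lets $a$ be the minimizer over $G$ of $l\mapsto\sum_{i} d(l,y_i)^2$, and chooses each $y_i$ with probability $\frac1{2n}$ and $a$ with probability $\frac12$. Theorem. Let $q=2/3$. 1. For every metric tree $G$ and every $n\ge1$, each $f_i$ is a boomerang mechanism (so randomized DGM is an instance of the parameterized boomerang mechanism, with the $f_i$ and uniform weights), randomized DGM is SP, and it is a $1.83$-approximation. 2. For every metric tree $G$ with at least two points, every even $n\ge 2$ and every deterministic SP mechanism $f:G^n\to G$: if $f$ is an $\alpha$-approximation, then $\alpha\ge 2$. -/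

import Mathlib

open scoped ENNReal

noncomputable section

namespace FacilityLocation

/-- A metric tree: any two points are joined by exactly one arc, and the distance between them is
the length of that arc. Finite tree networks, with the length of the path between two points as
their distance, are of this kind. -/
structure IsTree (G : Type*) [MetricSpace G] : Prop where
  /-- Any two points are joined by a curve, parametrized by arc length, whose length is their
  distance. -/
  exists_geodesic : ∀ a b : G, ∃ γ : ℝ → G, γ 0 = a ∧ γ (dist a b) = b ∧
    ∀ s ∈ Set.Icc 0 (dist a b), ∀ t ∈ Set.Icc 0 (dist a b), dist (γ s) (γ t) = |s - t|
  /-- There are no cycles: any two simple paths with the same endpoints have the same image. -/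
  arc_unique : ∀ (a b : G) (γ γ' : Path a b), Function.Injective γ → Function.Injective γ' →
    Set.range γ = Set.range γ'

variable {G : Type*} [MetricSpace G]

/-- The path between `a` and `b`: the points that lie between `a` and `b`. -/
def path (a b : G) : Set G := {z | dist a z + dist z b = dist a b}

/-- The subtree at `a` (with its root `a` removed) that contains `z`, for `z ≠ a`: the points that
can be reached from `z` without passing through `a`. -/
def branch (a z : G) : Set G := {w | a ∉ path z w}

/-- A deterministic mechanism for `n` agents maps reported profiles to a facility location. -/
abbrev DetMechanism (n : ℕ) (G : Type*) : Type _ := (Fin n → G) → G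

/-- A randomized mechanism for `n` agents maps reported profiles to a lottery over locations. -/
abbrev RandMechanism (n : ℕ) (G : Type*) : Type _ := (Fin n → G) → PMF G

/-- The sum of squared distances of the agents from the facility location `y`. -/
def socialCost {n : ℕ} (y : G) (x : Fin n → G) : ℝ := ∑ i, dist y (x i) ^ 2

/-- The optimal social cost of a profile. -/
def optCost {n : ℕ} (x : Fin n → G) : ℝ := ⨅ y : G, socialCost y x

/-- The expectation of a nonnegative quantity `g` under the lottery `P`. -/
def expect (P : PMF G) (g : G → ℝ) : ℝ≥0∞ := ∑' y, P y * ENNReal.ofReal (g y)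

/-- A deterministic mechanism is strategyproof if no agent can benefit from misreporting. -/
def DetStrategyproof {n : ℕ} (f : DetMechanism n G) : Prop :=
  ∀ (x : Fin n → G) (i : Fin n) (x' : G),
    dist (f x) (x i) ≤ dist (f (Function.update x i x')) (x i)

/-- A randomized mechanism is strategyproof if no agent can decrease her expected distance from
the facility by misreporting. -/
def RandStrategyproof {n : ℕ} (F : RandMechanism n G) : Prop :=
  ∀ (x : Fin n → G) (i : Fin n) (x' : G),
    expect (F x) (fun y => dist y (x i)) ≤
      expect (F (Function.update x i x')) (fun y => dist y (x i))

/-- The deterministic mechanism `f` provides an `α`-approximation of the optimal social cost. -/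
def DetApproximates {n : ℕ} (α : ℝ) (f : DetMechanism n G) : Prop :=
  ∀ x : Fin n → G, socialCost (f x) x ≤ α * optCost x

/-- The randomized mechanism `F` provides an `α`-approximation of the optimal social cost. -/
def RandApproximates {n : ℕ} (α : ℝ) (F : RandMechanism n G) : Prop :=
  ∀ x : Fin n → G, expect (F x) (fun y => socialCost y x) ≤ ENNReal.ofReal (α * optCost x)

/-- A boomerang mechanism: a deviating agent fully absorbs the effect of her deviation on the
facility location. -/
def IsBoomerang {n : ℕ} (f : DetMechanism n G) : Prop :=
  ∀ (x : Fin n → G) (i : Fin n) (x' : G),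
    dist (f (Function.update x i x')) (x i) - dist (f x) (x i) =
      dist (f (Function.update x i x')) (f x)

/-- `a` minimizes the `w`-weighted sum of squared distances from the locations `y`. -/
def IsWAvg {m : ℕ} (y : Fin m → G) (w : PMF (Fin m)) (a : G) : Prop :=
  ∀ l : G, ∑ j, (w j).toReal * dist a (y j) ^ 2 ≤ ∑ j, (w j).toReal * dist l (y j) ^ 2

/-- The weighted average location; on a tree it exists and is unique. -/
def wAvg [Nonempty G] {m : ℕ} (y : Fin m → G) (w : PMF (Fin m)) : G :=
  Classical.epsilon (IsWAvg y w)

/-- The parameterized boomerang mechanism: toss a fair coin; on heads choose `f j x`, where `j` is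
drawn from `w`, and on tails choose the `w`-weighted average of the locations `f j x`. (The `f j`
are meant to be boomerang mechanisms.) -/
def parameterizedBoomerang [Nonempty G] {n m : ℕ} (f : Fin m → DetMechanism n G)
    (w : PMF (Fin m)) : RandMechanism n G := fun x =>
  (PMF.uniformOfFintype Bool).bind fun heads =>
    if heads then w.map (fun j => f j x) else PMF.pure (wAvg (fun j => f j x) w)

/-- The subtree at `a` that contains `z` (without its root `a`) contains at least a fraction `q`
of the agents. -/
def IsHeavy {n : ℕ} (q : ℝ) (x : Fin n → G) (a z : G) : Prop :=
  q * n ≤ ({j : Fin n | x j ∈ branch a z}.ncard : ℝ)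

/-- `a` is the point where the walk stops that starts at the root `r` and keeps moving into a
subtree with at least a fraction `q` of the agents as long as there is one: at every point `b`
passed on the way from `r` to `a` the subtree towards `a` is such a subtree, and at `a` there is
no such subtree. -/
def IsStop {n : ℕ} (q : ℝ) (x : Fin n → G) (r a : G) : Prop :=
  (∀ b ∈ path r a, b ≠ a → IsHeavy q x b a) ∧ ∀ z, z ≠ a → ¬ IsHeavy q x a z

/-- The dictatorial generalized median with dictator `i` and fraction `q`; on a tree, and for
`1 / 2 < q ≤ 1`, the stopping point exists and is unique. -/
def dgm [Nonempty G] {n : ℕ} (q : ℝ) (i : Fin n) : DetMechanism n G := fun x =>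
  Classical.epsilon (IsStop q x (x i))

/-- The randomized DGM mechanism: the parameterized boomerang mechanism with the uniform
distribution over the `n` dictatorial generalized medians with fraction `q`. -/
def randomizedDGM [Nonempty G] (n : ℕ) [NeZero n] (q : ℝ) : RandMechanism n G :=
  parameterizedBoomerang (fun i => dgm q i) (PMF.uniformOfFintype (Fin n))

end FacilityLocation

end

open FacilityLocation

namespace FacilityLocation

/-! ### Paths, medians and branches in a metric tree. -/

variable {G : Type*} [MetricSpace G]

/-! Strategyproofness. When agent `i` deviates, the old stop of each walk lies between `x i` and the
new one (`isStop_mem_path_update`): this is the boomerang property. So on heads the deviation costs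
her exactly the average displacement of the chosen points. On tails it gains at most that much,
because averaging in a nonpositively curved space is 1-Lipschitz (`dist_minimizer_le`).

Approximation. Three stops off a common path would have three disjoint sets of agents behind them,
each with more than a third of all agents. Hence for `q = 2 / 3` all stops lie on one path, and
agent `j` hangs off it at her stop, at height `h j`. Costs on the path depend only on the
coordinates `t j` of the stops and on the heights. A competitor `o` off the path can be nearer than
its projection only to the agents who leave the path there on its side, and they are at most `n /
3`, since their walks entered a branch holding `2 * n / 3` others. What remains is a quadratic
inequality (`estimate`).

Lower bound. A deterministic strategyproof mechanism ignores agents moving to the facility. From a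
profile split evenly between two points this yields an even split with the facility at one of its
two points, twice as costly as the midpoint. -/

theorem mem_path {a b z : G} : z ∈ path a b ↔ dist a z + dist z b = dist a b := Iff.rfl

theorem path_comm (a b : G) : path a b = path b a := by
  ext z
  rw [mem_path, mem_path, dist_comm a z, dist_comm z b, dist_comm a b, add_comm]

theorem left_mem_path (a b : G) : a ∈ path a b := by simp [mem_path]

theorem right_mem_path (a b : G) : b ∈ path a b := by simp [mem_path]

theorem eq_of_mem_path_self {a z : G} (h : z ∈ path a a) : z = a := by
  rw [mem_path, dist_self, dist_comm z a] at h
  have := dist_nonneg (x := a) (y := z)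
  exact (dist_le_zero.1 (by linarith)).symm

/-- The part of a path up to one of its points is contained in the path. -/
theorem mem_path_of_mem_left {a b z w : G} (hz : z ∈ path a b) (hw : w ∈ path a z) :
    w ∈ path a b := by
  rw [mem_path] at *
  linarith [dist_triangle w z b, dist_triangle a w b]

theorem mem_path_of_mem_right {a b z w : G} (hz : z ∈ path a b) (hw : w ∈ path z b) :
    w ∈ path a b := by
  rw [mem_path] at *
  linarith [dist_triangle a z w, dist_triangle a w b]

/-- If `w` precedes `z` on the path from `a` to `b`, then `z` lies between `w` and `b`. -/
theorem mem_path_of_mem_of_mem {a b z w : G} (hz : z ∈ path a b) (hw : w ∈ path a z) :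
    z ∈ path w b := by
  rw [mem_path] at *
  linarith [dist_triangle w z b, dist_triangle a w b]

theorem eq_of_mem_path_of_mem_path {a z w : G} (hz : z ∈ path a w) (hw : w ∈ path a z) :
    z = w := by
  rw [mem_path] at *
  rw [dist_comm w z] at hw
  exact dist_le_zero.1 (by linarith)

theorem trans_injective {X : Type*} [TopologicalSpace X] {a b c : X} {p : Path a b} {q : Path b c}
    (hp : Function.Injective p) (hq : Function.Injective q) (h : ∀ s t, p s = q t → p s = b) :
    Function.Injective (p.trans q) := by
  have key : ∀ s t : unitInterval, (s : ℝ) ≤ 1 / 2 → ¬ (t : ℝ) ≤ 1 / 2 →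
      p.trans q s ≠ p.trans q t := by
    intro s t hs ht hst
    rw [Path.trans_apply, Path.trans_apply, dif_pos hs, dif_neg ht] at hst
    have h1 := h _ _ hst
    rw [hst] at h1
    have h2 := hq (h1.trans q.source.symm)
    have h3 := congrArg Subtype.val h2
    simp only [Set.Icc.coe_zero] at h3
    apply ht
    linarith
  intro s t hst
  by_cases hs : (s : ℝ) ≤ 1 / 2 <;> by_cases ht : (t : ℝ) ≤ 1 / 2
  · rw [Path.trans_apply, Path.trans_apply, dif_pos hs, dif_pos ht] at hst
    have := congrArg Subtype.val (hp hst)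
    simp only at this
    exact Subtype.ext (by linarith)
  · exact absurd hst (key s t hs ht)
  · exact absurd hst.symm (key t s ht hs)
  · rw [Path.trans_apply, Path.trans_apply, dif_neg hs, dif_neg ht] at hst
    have := congrArg Subtype.val (hq hst)
    simp only at this
    exact Subtype.ext (by linarith)

namespace IsTree

variable (hG : IsTree G)
include hG

/-- Any two points are joined by a path of constant speed. -/
theorem exists_linear_path (a b : G) :
    ∃ p : Path a b, ∀ s t, dist (p s) (p t) = |(s : ℝ) - t| * dist a b := by
  obtain ⟨γ, h0, h1, hγ⟩ := hG.exists_geodesic a b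
  have hm : ∀ s : unitInterval, (s : ℝ) * dist a b ∈ Set.Icc 0 (dist a b) := fun s =>
    ⟨mul_nonneg s.2.1 dist_nonneg, mul_le_of_le_one_left dist_nonneg s.2.2⟩
  have hd : ∀ s t : unitInterval, dist (γ (s * dist a b)) (γ (t * dist a b)) =
      |(s : ℝ) - t| * dist a b := by
    intro s t
    rw [hγ _ (hm s) _ (hm t), ← sub_mul, abs_mul, abs_of_nonneg (dist_nonneg (x := a) (y := b))]
  refine ⟨⟨⟨fun s => γ (s * dist a b), ?_⟩, by simp [h0], by simp [h1]⟩, hd⟩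
  refine (LipschitzWith.of_dist_le_mul (K := ⟨dist a b, dist_nonneg⟩) fun s t => ?_).continuous
  rw [hd, Subtype.dist_eq, Real.dist_eq, mul_comm]
  rfl

omit hG in
theorem injective_of_linear {a b : G} (hab : a ≠ b) {p : Path a b}
    (hp : ∀ s t, dist (p s) (p t) = |(s : ℝ) - t| * dist a b) : Function.Injective p := by
  intro s t hst
  have h := hp s t
  rw [hst, dist_self, eq_comm, mul_eq_zero, abs_eq_zero, sub_eq_zero] at h
  exact Subtype.ext (h.resolve_right (dist_ne_zero.2 hab))

omit hG in
theorem dist_left_of_linear {a b : G} {p : Path a b}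
    (hp : ∀ s t, dist (p s) (p t) = |(s : ℝ) - t| * dist a b) (s : unitInterval) :
    dist a (p s) = s * dist a b := by
  have h := hp 0 s
  rw [p.source] at h
  rw [h, Set.Icc.coe_zero, zero_sub, abs_neg, abs_of_nonneg s.2.1]

omit hG in
theorem mem_path_of_linear {a b : G} {p : Path a b}
    (hp : ∀ s t, dist (p s) (p t) = |(s : ℝ) - t| * dist a b) (s : unitInterval) :
    p s ∈ path a b := by
  have h := hp s 1
  rw [p.target, Set.Icc.coe_one, abs_of_nonpos (by linarith [s.2.2])] at h
  rw [mem_path, dist_left_of_linear hp, h]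
  ring

/-- If two geodesics meet only in their common endpoint, their concatenation is a geodesic. -/
theorem range_eq_of_meet {a m c : G} (ham : a ≠ m) (hmc : m ≠ c)
    (h : ∀ w, w ∈ path a m → w ∈ path m c → w = m) {r : Path a c}
    (hr : ∀ s t, dist (r s) (r t) = |(s : ℝ) - t| * dist a c) : m ∈ Set.range r := by
  obtain ⟨p, hp⟩ := hG.exists_linear_path a m
  obtain ⟨q, hq⟩ := hG.exists_linear_path m c
  have hac : a ≠ c := by
    rintro rfl
    exact ham (h a (left_mem_path _ _) (right_mem_path _ _))
  have hi : Function.Injective (p.trans q) :=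
    trans_injective (injective_of_linear ham hp) (injective_of_linear hmc hq) fun s t hst =>
      h _ (mem_path_of_linear hp s) (hst ▸ mem_path_of_linear hq t)
  rw [hG.arc_unique a c r (p.trans q) (injective_of_linear hac hr) hi, Path.trans_range]
  exact Or.inl ⟨1, p.target⟩

/-- Without backtracking at `m`, the two geodesics form an arc, and the only arc from `a` to `c` is
the geodesic. -/
theorem mem_path_of_meet {a m c : G} (h : ∀ w, w ∈ path a m → w ∈ path m c → w = m) :
    m ∈ path a c := by
  rcases eq_or_ne a m with rfl | ham
  · exact left_mem_path _ _
  rcases eq_or_ne m c with rfl | hmc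
  · exact right_mem_path _ _
  obtain ⟨r, hr⟩ := hG.exists_linear_path a c
  obtain ⟨s, rfl⟩ := hG.range_eq_of_meet ham hmc h hr
  exact mem_path_of_linear hr s

/-- By the triangle inequality, geodesics to and from such a `z` meet only in `z`. Thus metric
betweenness agrees with lying on the arc, which makes `path a b` compact and linearly ordered. -/
theorem mem_range_of_mem_path {a b z : G} (hz : z ∈ path a b) {r : Path a b}
    (hr : ∀ s t, dist (r s) (r t) = |(s : ℝ) - t| * dist a b) : z ∈ Set.range r := by
  rcases eq_or_ne a z with rfl | haz
  · exact ⟨0, r.source⟩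
  rcases eq_or_ne z b with rfl | hzb
  · exact ⟨1, r.target⟩
  refine hG.range_eq_of_meet haz hzb (fun w h1 h2 => ?_) hr
  rw [mem_path] at *
  rw [dist_comm z w] at h2
  exact dist_le_zero.1 (by linarith [dist_triangle a w b])

theorem path_eq_range {a b : G} {r : Path a b}
    (hr : ∀ s t, dist (r s) (r t) = |(s : ℝ) - t| * dist a b) : path a b = Set.range r :=
  Set.Subset.antisymm (fun _ hz => hG.mem_range_of_mem_path hz hr)
    (by rintro _ ⟨s, rfl⟩; exact mem_path_of_linear hr s)

theorem isCompact_path (a b : G) : IsCompact (path a b) := by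
  obtain ⟨r, hr⟩ := hG.exists_linear_path a b
  rw [hG.path_eq_range hr]
  exact isCompact_range r.continuous

theorem dist_eq_of_mem_path {a b z w : G} (hz : z ∈ path a b) (hw : w ∈ path a b) :
    dist z w = |dist a z - dist a w| := by
  obtain ⟨r, hr⟩ := hG.exists_linear_path a b
  obtain ⟨s, rfl⟩ := hG.mem_range_of_mem_path hz hr
  obtain ⟨t, rfl⟩ := hG.mem_range_of_mem_path hw hr
  rw [hr, dist_left_of_linear hr, dist_left_of_linear hr, ← sub_mul, abs_mul,
    abs_of_nonneg (dist_nonneg (x := a) (y := b))]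

/-- The path from `a` to `b` contains a point dividing it in any given ratio. -/
theorem exists_mem_path_dist_eq (a b : G) {s : ℝ} (h0 : 0 ≤ s) (h1 : s ≤ dist a b) :
    ∃ z ∈ path a b, dist a z = s := by
  rcases eq_or_ne a b with rfl | hab
  · exact ⟨a, left_mem_path _ _, by rw [dist_self] at *; linarith⟩
  obtain ⟨r, hr⟩ := hG.exists_linear_path a b
  have hd := dist_pos.2 hab
  refine ⟨r ⟨s / dist a b, by positivity, (div_le_one hd).2 h1⟩, mem_path_of_linear hr _, ?_⟩
  rw [dist_left_of_linear hr]
  exact div_mul_cancel₀ _ hd.ne'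

/-- Take the point `m` of `path a b` nearest to `c`: the path from `m` to `c` meets `path a b` only
in `m`, so both ways through `m` are geodesic. -/
theorem exists_median (a b c : G) : ∃ m, m ∈ path a b ∧ m ∈ path a c ∧ m ∈ path b c := by
  obtain ⟨m, hm, hmin⟩ := (hG.isCompact_path a b).exists_isMinOn ⟨a, left_mem_path _ _⟩
    (f := fun z => dist z c) (by fun_prop)
  have key : ∀ w ∈ path a b, w ∈ path m c → w = m := by
    intro w h1 h2
    have h3 : dist m c ≤ dist w c := hmin h1
    rw [mem_path] at h2
    exact (dist_le_zero.1 (by linarith)).symm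
  refine ⟨m, hm, hG.mem_path_of_meet fun w h1 h2 => key w (mem_path_of_mem_left hm h1) h2,
    hG.mem_path_of_meet fun w h1 h2 => key w ?_ h2⟩
  rw [path_comm] at h1
  exact mem_path_of_mem_right hm h1

/-- Two points of a path are ordered along it. -/
theorem mem_path_or {a b z w : G} (hz : z ∈ path a b) (hw : w ∈ path a b) :
    w ∈ path a z ∨ z ∈ path a w := by
  have h := hG.dist_eq_of_mem_path hz hw
  rw [mem_path, mem_path]
  rcases abs_cases (dist a z - dist a w) with ⟨h1, _⟩ | ⟨h1, _⟩
  · left; rw [dist_comm w z]; linarith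
  · right; linarith

theorem mem_path_or' {a b z w : G} (hz : z ∈ path a b) (hw : w ∈ path a b) :
    w ∈ path a z ∨ w ∈ path z b :=
  (hG.mem_path_or hz hw).imp_right fun h => mem_path_of_mem_of_mem hw h

/-- The three equations determine `dist a m`, and a point of `path a b` is determined by its
distance from `a`. -/
theorem median_unique {a b c m m' : G} (h1 : m ∈ path a b) (h2 : m ∈ path a c)
    (h3 : m ∈ path b c) (h1' : m' ∈ path a b) (h2' : m' ∈ path a c) (h3' : m' ∈ path b c) :
    m = m' := by
  have h := hG.dist_eq_of_mem_path h1 h1'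
  rw [mem_path] at *
  rw [dist_comm b m] at h3
  rw [dist_comm b m'] at h3'
  have : dist a m - dist a m' = 0 := by linarith
  rw [this, abs_zero] at h
  exact dist_eq_zero.1 h

/-- Paths that overlap in more than a point can be glued. -/
theorem mem_path_glue {a b m m' : G} (h1 : m ∈ path a m') (h2 : m' ∈ path m b) (hne : m ≠ m') :
    m' ∈ path a b := by
  obtain ⟨c, c1, c2, c3⟩ := hG.exists_median a m' b
  suffices c = m' by rwa [this] at c2
  rcases hG.mem_path_or' h1 c1 with h | h
  · exfalso
    apply hne
    have h4 : m ∈ path m' c := by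
      rw [path_comm]; exact mem_path_of_mem_of_mem h1 h
    have h5 := mem_path_of_mem_left c3 h4
    rw [mem_path] at *
    rw [dist_comm m' m] at h5
    exact dist_le_zero.1 (by linarith)
  · have h4 := mem_path_of_mem_of_mem h2 h
    rw [mem_path] at *
    rw [dist_comm m' c] at c3
    exact dist_le_zero.1 (by linarith)

/-- The median splits `path x z` into a piece of `path x y` and a piece of `path y z`. So sharing a
branch at `e` is a transitive relation. -/
theorem notMem_path_trans {e x y z : G} (h1 : e ∉ path x y) (h2 : e ∉ path y z) :
    e ∉ path x z := by
  intro h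
  obtain ⟨m, m1, m2, m3⟩ := hG.exists_median x y z
  rcases hG.mem_path_or' m2 h with h' | h'
  · exact h1 (mem_path_of_mem_left m1 h')
  · exact h2 (mem_path_of_mem_right m3 h')

/-- Finitely many paths from a point `e` have a largest common initial piece, which ends where
two of the paths part. -/
theorem exists_parting_point {ι : Type*} {K : Finset ι} (e : G) (p : ι → G) {i : ι} (hi : i ∈ K) :
    ∃ c, (∀ k ∈ K, c ∈ path e (p k)) ∧ ∃ k ∈ K, c ∈ path (p i) (p k) := by
  choose m h1 h2 h3 using fun k => hG.exists_median e (p i) (p k)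
  -- The path that parts earliest from the path to `p i` determines the common piece.
  obtain ⟨k, hk, hmin⟩ := K.exists_min_image (fun k => dist e (m k)) ⟨i, hi⟩
  refine ⟨m k, fun l hl => ?_, k, hk, h3 k⟩
  refine mem_path_of_mem_left (h2 l) ?_
  rcases hG.mem_path_or (h1 l) (h1 k) with h | h
  · exact h
  · have h4 := hmin l hl
    have : m l = m k := by
      rw [mem_path] at h
      exact dist_le_zero.1 (by linarith)
    rw [this]
    exact right_mem_path _ _

/-- Finitely many paths from `e` whose other endpoints lie in one branch at `e` have a common
initial piece. -/
theorem exists_common_start {ι : Type*} {K : Finset ι} (p : ι → G) {e : G} {i : ι} (hi : i ∈ K)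
    (hK : ∀ k ∈ K, e ∉ path (p i) (p k)) :
    ∃ c ≠ e, (∀ k ∈ K, c ∈ path e (p k)) ∧ ∃ k ∈ K, c ∈ path (p i) (p k) := by
  obtain ⟨c, hc, k, hk, hck⟩ := hG.exists_parting_point e p hi
  exact ⟨c, fun h => hK k hk (h ▸ hck), hc, k, hk, hck⟩

end IsTree

theorem mem_path_of_mem_of_mem_right {a b z w : G} (hz : z ∈ path a b) (hw : w ∈ path z b) :
    z ∈ path a w := by
  rw [path_comm] at *
  exact mem_path_of_mem_of_mem hz hw

/-! ### Heavy branches, stopping points and the boomerang property. -/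

section Heavy

variable {n : ℕ} {q : ℝ} {x x' : Fin n → G} {a a' z z' : G}

theorem IsHeavy.mono (h : IsHeavy q x a z) (hm : ∀ j, a ∉ path z (x j) → a' ∉ path z' (x' j)) :
    IsHeavy q x' a' z' :=
  h.trans (Nat.cast_le.2 (Set.ncard_le_ncard (fun j hj => hm j hj) (Set.toFinite _)))

theorem IsHeavy.add_ncard_le (h : IsHeavy q x a z) {s : Set (Fin n)}
    (hs : ∀ j ∈ s, a ∈ path z (x j)) : q * n + s.ncard ≤ n := by
  have hd : Disjoint {j : Fin n | x j ∈ branch a z} s :=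
    Set.disjoint_left.2 fun j h1 h2 => h1 (hs j h2)
  have h1 := Set.ncard_union_eq hd (Set.toFinite _) (Set.toFinite _)
  have h2 := Set.ncard_le_card ({j : Fin n | x j ∈ branch a z} ∪ s)
  rw [Nat.card_eq_fintype_card, Fintype.card_fin] at h2
  have h3 : ((Set.ncard {j : Fin n | x j ∈ branch a z} : ℕ) : ℝ) + s.ncard ≤ n := by
    exact_mod_cast h1 ▸ h2
  have h4 : q * n ≤ _ := h
  linarith

/-- Each of the two branches holds a majority of the agents. -/
theorem IsHeavy.exists_mem_inter (hq : 1 / 2 < q) (hn : 0 < n) (h : IsHeavy q x a z)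
    (h' : IsHeavy q x a' z') : ∃ j, a ∉ path z (x j) ∧ a' ∉ path z' (x j) := by
  by_contra! hc
  have h1 := h'.add_ncard_le (s := {j : Fin n | x j ∈ branch a z}) hc
  have h2 : q * n ≤ _ := h
  have hn' : (0 : ℝ) < n := by exact_mod_cast hn
  nlinarith

theorem IsHeavy.exists_mem (hq : 0 < q) (hn : 0 < n) (h : IsHeavy q x a z) :
    ∃ j, a ∉ path z (x j) := by
  have hn' : (0 : ℝ) < n := by exact_mod_cast hn
  have h1 : (0 : ℝ) < ({j : Fin n | x j ∈ branch a z}.ncard : ℝ) :=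
    (mul_pos hq hn').trans_le h
  exact Set.nonempty_of_ncard_ne_zero (Nat.cast_pos.1 h1).ne'

/-- A branch with many agents that contains the path to a central point would give a branch with
many agents at that point. -/
theorem not_isHeavy_of_central {p p' m : G} (hp' : ∀ z, z ≠ p' → ¬ IsHeavy q x p' z)
    (hm : m ∈ path p p') (hne : m ≠ p) : ¬ IsHeavy q x m p := fun h => by
  refine hp' p ?_ (h.mono fun j hj hj' => hj ?_)
  · rintro rfl
    exact hne (eq_of_mem_path_self hm)
  · exact mem_path_of_mem_left hj' hm

end Heavy

namespace IsTree

variable (hG : IsTree G) {n : ℕ} {q : ℝ}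
include hG

theorem exists_isStop (hq : 1 / 2 < q) (hn : 0 < n) (x : Fin n → G) (r : G) :
    ∃ a, IsStop q x r a := by
  classical
  choose m h1 h2 h3 using fun j k => hG.exists_median r (x j) (x k)
  -- The walk can be tracked on finitely many points, the root and the branching points; the
  -- farthest one reached is the stop.
  let S : Set G := {b | (∀ c ∈ path r b, c ≠ b → IsHeavy q x c b) ∧
    (b = r ∨ b ∈ Set.range fun jk : Fin n × Fin n => m jk.1 jk.2)}
  have hS : S.Finite :=
    ((Set.finite_singleton r).union (Set.finite_range _)).subset fun b hb => hb.2
  obtain ⟨b, hb, hmax⟩ := S.exists_max_image (dist r) hS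
    ⟨r, fun c hc hcr => absurd (eq_of_mem_path_self hc) hcr, Or.inl rfl⟩
  refine ⟨b, hb.1, fun z _ hz => ?_⟩
  obtain ⟨i, hi⟩ := hz.exists_mem (by linarith) hn
  let K : Finset (Fin n) := {k | b ∉ path z (x k)}
  have hK : ∀ {k}, k ∈ K ↔ b ∉ path z (x k) := by simp [K]
  have hiK : ∀ k ∈ K, b ∉ path (x i) (x k) := fun k hk =>
    hG.notMem_path_trans (by rwa [path_comm]) (hK.1 hk)
  -- A heavy branch leading away from `r` would carry the walk on to a farther branching point `c`.
  -- One leading back towards `r` would be disjoint from the heavy branch by which the walk arrived.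
  by_cases hbr : b ∈ path r (x i)
  · obtain ⟨c, hcb, hc, k, hk, c3⟩ := hG.exists_common_start x (hK.2 hi) hiK
    have c1 := hc i (hK.2 hi)
    have c2 := hc k hk
    have hbc : b ∈ path r c := mem_path_of_mem_of_mem_right hbr c1
    have hcm : c = m i k := hG.median_unique (mem_path_of_mem_right hbr c1)
      (hG.mem_path_glue hbc c2 hcb.symm) c3 (h1 i k) (h2 i k) (h3 i k)
    have hcS : c ∈ S := by
      refine ⟨fun d hd hdc => ?_, Or.inr ⟨(i, k), hcm.symm⟩⟩
      by_cases hdb : d ∈ path r b ∧ d ≠ b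
      · refine (hb.1 d hdb.1 hdb.2).mono fun j hj => ?_
        refine hG.notMem_path_trans (fun h => hdb.2 ?_) hj
        rw [path_comm] at h
        have h4 := mem_path_of_mem_of_mem hbc hdb.1
        rw [path_comm] at h h4
        exact eq_of_mem_path_of_mem_path h h4
      · have hdb' : d ∈ path b c := by
          rcases hG.mem_path_or' hbc hd with h | h
          · have : d = b := by by_contra h'; exact hdb ⟨h, h'⟩
            rw [this]
            exact left_mem_path _ _
          · exact h
        refine hz.mono fun j hj hj' => hdc ?_
        have h4 := mem_path_of_mem_of_mem (hc j (hK.2 hj)) hdb'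
        rw [path_comm] at h4 hj'
        exact eq_of_mem_path_of_mem_path hj' h4
    have h5 := hmax c hcS
    rw [mem_path] at hbc
    have := dist_pos.2 hcb.symm
    linarith
  · have hrK : ∀ k ∈ K, b ∉ path r (x k) := fun k hk =>
      hG.notMem_path_trans hbr (hiK k hk)
    obtain ⟨c, hcb, hc, -⟩ := hG.exists_common_start (K := insert r (K.image x)) id
      (Finset.mem_insert_self r _) (e := b) (by
        intro y hy
        rcases Finset.mem_insert.1 hy with rfl | hy
        · exact fun h => hbr (eq_of_mem_path_self h ▸ left_mem_path _ _)
        · obtain ⟨k, hk, rfl⟩ := Finset.mem_image.1 hy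
          exact hrK k hk)
    have hcr : c ∈ path r b := by
      rw [path_comm]; exact hc r (Finset.mem_insert_self r _)
    obtain ⟨j, j1, j2⟩ := hz.exists_mem_inter hq hn (hb.1 c hcr hcb)
    exact j2 (hc (x j) (Finset.mem_insert_of_mem (Finset.mem_image_of_mem x (hK.2 j1))))

theorem isStop_dgm [Nonempty G] (hq : 1 / 2 < q) (hn : 0 < n) (x : Fin n → G) (i : Fin n) :
    IsStop q x (x i) (dgm q i x) :=
  Classical.epsilon_spec (hG.exists_isStop hq hn x (x i))

/-- If an agent deviates, then the old stopping point lies between her location and the new one. -/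
theorem isStop_mem_path_update {x : Fin n → G} {i j : Fin n} {xi p p' : G}
    (hp : IsStop q x (x j) p)
    (hp' : IsStop q (Function.update x i xi) (Function.update x i xi j) p') :
    p ∈ path (x i) p' := by
  by_contra h
  obtain ⟨c, c1, c2, c3⟩ := hG.exists_median (x i) p p'
  have hcp : c ≠ p := by rintro rfl; exact h c2
  have hpp : p' ≠ p := by rintro rfl; exact h (right_mem_path _ _)
  -- Agent `i` is not in the branch at `e` towards `p`, so it stays heavy after the deviation, and
  -- `p'` could not be a stop.
  suffices ∃ e ∈ path p p', e ≠ p ∧ IsHeavy q x e p ∧ e ∈ path (x i) p by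
    obtain ⟨e, e1, e2, e3, e4⟩ := this
    refine not_isHeavy_of_central hp'.2 e1 e2 (e3.mono fun k hk => ?_)
    rcases eq_or_ne k i with rfl | hki
    · rw [path_comm] at hk
      exact absurd e4 hk
    · rwa [Function.update_of_ne hki]
  rcases eq_or_ne j i with rfl | hji
  · exact ⟨c, c3, hcp, hp.1 c c1 hcp, c1⟩
  rw [Function.update_of_ne hji] at hp'
  obtain ⟨m, m1, m2, m3⟩ := hG.exists_median (x j) p p'
  -- Otherwise the new walk passes `p` and finds the branch towards `p'` heavy. Since `x i` lies in
  -- that branch, it was already heavy before the deviation, against `p` being a stop.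
  have hmp : m ≠ p := by
    rintro rfl
    refine hp.2 p' hpp ((hp'.1 m m2 hpp.symm).mono fun k hk => ?_)
    rcases eq_or_ne k i with rfl | hki
    · rwa [path_comm]
    · rwa [Function.update_of_ne hki] at hk
  -- Whichever of `c` and `m` is nearer to `p` serves as `e`.
  rcases hG.mem_path_or m3 c3 with h' | h'
  · refine ⟨c, c3, hcp, hp.1 c (mem_path_of_mem_right m1 ?_) hcp, c1⟩
    rwa [path_comm]
  · refine ⟨m, m3, hmp, hp.1 m m1 hmp, mem_path_of_mem_right c1 ?_⟩
    rwa [path_comm]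

theorem isBoomerang_dgm [Nonempty G] (hq : 1 / 2 < q) (hn : 0 < n) (i : Fin n) :
    IsBoomerang (dgm q i : DetMechanism n G) := by
  intro x k xi
  have h := hG.isStop_mem_path_update (hG.isStop_dgm hq hn x i)
    (hG.isStop_dgm hq hn (Function.update x k xi) i)
  rw [mem_path] at h
  rw [dist_comm _ (x k), dist_comm _ (x k), dist_comm (dgm q i (Function.update x k xi)) (dgm q i x)]
  linarith

end IsTree

/-! ### Nonpositive curvature and weighted averages. -/

namespace IsTree

variable (hG : IsTree G)
include hG

/-- Trees are nonpositively curved. -/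
theorem dist_sq_le_of_mem_path {a z p : G} (y : G) (hp : p ∈ path a z) {t : ℝ} (h0 : 0 ≤ t)
    (h1 : t ≤ 1) (ht : dist a p = t * dist a z) :
    dist p y ^ 2 ≤ (1 - t) * dist a y ^ 2 + t * dist z y ^ 2 - t * (1 - t) * dist a z ^ 2 := by
  obtain ⟨m, m1, m2, m3⟩ := hG.exists_median a z y
  have h2 := hG.dist_eq_of_mem_path hp m1
  have h3 := dist_triangle p m y
  rw [mem_path] at m1 m2 m3
  rw [ht] at h2
  rw [dist_comm z m] at m3
  have hα := dist_nonneg (x := a) (y := m)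
  have hβ := dist_nonneg (x := m) (y := z)
  have hh := dist_nonneg (x := m) (y := y)
  rw [← m2, ← m3]
  rw [← m1] at h2 ⊢
  generalize dist a m = α at *
  generalize dist m z = β at *
  generalize dist m y = h at *
  -- For `h = 0` the claim is an identity on the line; this convexity bound handles the cross term
  -- with `h`.
  have h4 : |t * (α + β) - α| ≤ (1 - t) * α + t * β := by
    rw [abs_le]
    constructor <;> nlinarith [mul_nonneg h0 hα, mul_nonneg h0 hβ, mul_nonneg (sub_nonneg.2 h1) hα]
  have h5 := sq_abs (t * (α + β) - α)
  rw [h2] at h3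
  calc dist p y ^ 2 ≤ (|t * (α + β) - α| + h) ^ 2 := by gcongr
    _ = (t * (α + β) - α) ^ 2 + 2 * h * |t * (α + β) - α| + h ^ 2 := by rw [← h5]; ring
    _ ≤ (t * (α + β) - α) ^ 2 + 2 * h * ((1 - t) * α + t * β) + h ^ 2 := by gcongr
    _ = _ := by ring

/-- The quadrilateral inequality. -/
theorem quadrilateral (a a' y y' : G) :
    dist a' y ^ 2 + dist a y' ^ 2 ≤
      dist a y ^ 2 + dist a' y' ^ 2 + 2 * dist a a' * dist y y' := by
  obtain ⟨m, m1, m2, m3⟩ := hG.exists_median a a' y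
  obtain ⟨m', m1', m2', m3'⟩ := hG.exists_median a a' y'
  have hd := hG.dist_eq_of_mem_path m1 m1'
  -- Either `y` and `y'` project to the same point of `path a a'`, or the path between them runs
  -- through both projections.
  have key : (m = m' ∧ |dist m y - dist m' y'| ≤ dist y y') ∨
      dist y y' = dist m y + dist m m' + dist m' y' := by
    rcases eq_or_ne m m' with rfl | hne
    · refine Or.inl ⟨rfl, ?_⟩
      rw [abs_le]
      constructor
      · linarith [dist_triangle m y y']
      · linarith [dist_triangle m y' y, dist_comm y y']
    · right
      have aux : ∀ {m m' y : G}, m ∈ path a a' → m' ∈ path a a' → m ∈ path a y → m ∈ path a' y →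
          m ∈ path y m' := by
        intro m m' y h h' hy hy'
        rw [path_comm] at hy hy'
        rcases hG.mem_path_or' h h' with h4 | h4
        · rw [path_comm] at h4
          exact mem_path_of_mem_of_mem_right hy h4
        · exact mem_path_of_mem_of_mem_right hy' h4
      have h5 := aux m1 m1' m2 m3
      have h6 := aux m1' m1 m2' m3'
      rw [path_comm] at h6
      have h7 := hG.mem_path_glue h5 h6 hne
      rw [mem_path] at h5 h7
      rw [← h7, ← h5, dist_comm y m]
  rw [mem_path] at m1 m2 m3 m1' m2' m3'
  rw [dist_comm a' m] at m3
  rw [dist_comm a' m'] at m3'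
  rw [← m2, ← m3, ← m2', ← m3']
  have hα := dist_nonneg (x := a) (y := m)
  have hβ := dist_nonneg (x := m) (y := a')
  have hh := dist_nonneg (x := m) (y := y)
  have hα' := dist_nonneg (x := a) (y := m')
  have hβ' := dist_nonneg (x := m') (y := a')
  have hh' := dist_nonneg (x := m') (y := y')
  rcases key with ⟨rfl, h⟩ | h
  · rw [abs_le] at h
    rw [← m1]
    generalize dist a m = α at *
    generalize dist m a' = β at *
    generalize dist m y = k at *
    generalize dist m y' = k' at *
    nlinarith [mul_nonneg hα (sub_nonneg.2 h.1), mul_nonneg hβ (sub_nonneg.2 h.1),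
      mul_nonneg hα (sub_nonneg.2 h.2), mul_nonneg hβ (sub_nonneg.2 h.2)]
  · rw [h, hd]
    have h8 := le_abs_self (dist a m - dist a m')
    have h9 := neg_abs_le (dist a m - dist a m')
    generalize |dist a m - dist a m'| = ε at *
    have e1 : dist m a' = dist a a' - dist a m := by linarith
    have e2 : dist m' a' = dist a a' - dist a m' := by linarith
    rw [e1] at hβ
    rw [e2] at hβ'
    rw [e1, e2]
    generalize dist a m = α at *
    generalize dist a m' = α' at *
    generalize dist a a' = D at *
    generalize dist m y = k at *
    generalize dist m' y' = k' at *
    nlinarith [mul_nonneg hα hh, mul_nonneg hβ' hh', mul_nonneg (add_nonneg hα hβ)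
      (by linarith : 0 ≤ ε + (α - α'))]

variable {m : ℕ} {w : Fin m → ℝ}

/-- `G` need not be compact, but the hull of the `y j` is. From any `l`, moving to where the paths
to the `y j` part brings all of them no farther away and ends in the hull. -/
theorem exists_minimizer [NeZero m] (hw : ∀ j, 0 ≤ w j) (y : Fin m → G) :
    ∃ a, ∀ l, ∑ j, w j * dist a (y j) ^ 2 ≤ ∑ j, w j * dist l (y j) ^ 2 := by
  have hC : IsCompact (⋃ j, path (y 0) (y j)) := isCompact_iUnion fun j => hG.isCompact_path _ _
  obtain ⟨a, -, hmin⟩ := hC.exists_isMinOn ⟨y 0, Set.mem_iUnion.2 ⟨0, left_mem_path _ _⟩⟩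
    (f := fun l => ∑ j, w j * dist l (y j) ^ 2) (by fun_prop)
  refine ⟨a, fun l => ?_⟩
  obtain ⟨c, hc, k, -, hck⟩ := hG.exists_parting_point l y (Finset.mem_univ 0)
  refine (hmin (Set.mem_iUnion.2 ⟨k, hck⟩)).trans (Finset.sum_le_sum fun j _ => ?_)
  have h := hc j (Finset.mem_univ j)
  rw [mem_path] at h
  have h' := dist_nonneg (x := l) (y := c)
  have := hw j
  gcongr
  linarith

/-- Compare `a` with the point at fraction `t` of the way to `z`: minimality and curvature give `(1
- t) * D ^ 2 ≤ B - A`, and `t` tends to 0. -/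
theorem variance_le (hw : ∀ j, 0 ≤ w j) (hw1 : ∑ j, w j = 1) {y : Fin m → G} {a : G}
    (ha : ∀ l, ∑ j, w j * dist a (y j) ^ 2 ≤ ∑ j, w j * dist l (y j) ^ 2) (z : G) :
    ∑ j, w j * dist a (y j) ^ 2 + dist a z ^ 2 ≤ ∑ j, w j * dist z (y j) ^ 2 := by
  set A := ∑ j, w j * dist a (y j) ^ 2
  set B := ∑ j, w j * dist z (y j) ^ 2
  set D := dist a z
  have key : ∀ t, 0 < t → t ≤ 1 → (1 - t) * D ^ 2 ≤ B - A := by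
    intro t h0 h1
    obtain ⟨p, hp, hd⟩ := hG.exists_mem_path_dist_eq a z (s := t * D) (by positivity)
      (mul_le_of_le_one_left dist_nonneg h1)
    have h2 : A ≤ (1 - t) * A + t * B - t * (1 - t) * D ^ 2 :=
      calc A ≤ ∑ j, w j * dist p (y j) ^ 2 := ha p
        _ ≤ ∑ j, w j * ((1 - t) * dist a (y j) ^ 2 + t * dist z (y j) ^ 2 -
              t * (1 - t) * D ^ 2) := Finset.sum_le_sum fun j _ =>
            mul_le_mul_of_nonneg_left (hG.dist_sq_le_of_mem_path _ hp h0.le h1 hd) (hw j)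
        _ = (1 - t) * A + t * B - t * (1 - t) * D ^ 2 * ∑ j, w j := by
            simp only [A, B, Finset.mul_sum, ← Finset.sum_add_distrib, ← Finset.sum_sub_distrib]
            exact Finset.sum_congr rfl fun j _ => by ring
        _ = _ := by rw [hw1, mul_one]
    have h3 : t * ((1 - t) * D ^ 2) ≤ t * (B - A) := by linarith
    exact le_of_mul_le_mul_left h3 h0
  by_contra! h
  have h0 := key 1 one_pos le_rfl
  have hD : 0 < D ^ 2 := by linarith
  -- This `t` uses up only half of the gap `D ^ 2 - (B - A)`.
  have h1 := key ((D ^ 2 - (B - A)) / (2 * D ^ 2)) (div_pos (by linarith) (by linarith))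
    ((div_le_one (by linarith)).2 (by linarith))
  have h2 : (D ^ 2 - (B - A)) / (2 * D ^ 2) * D ^ 2 = (D ^ 2 - (B - A)) / 2 := by
    rw [div_mul_eq_mul_div, div_eq_div_iff (by linarith) two_ne_zero]
    ring
  linarith

/-- Passing to the weighted average location does not increase average distances. -/
theorem dist_minimizer_le (hw : ∀ j, 0 ≤ w j) (hw1 : ∑ j, w j = 1) {y y' : Fin m → G} {a a' : G}
    (ha : ∀ l, ∑ j, w j * dist a (y j) ^ 2 ≤ ∑ j, w j * dist l (y j) ^ 2)
    (ha' : ∀ l, ∑ j, w j * dist a' (y' j) ^ 2 ≤ ∑ j, w j * dist l (y' j) ^ 2) :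
    dist a a' ≤ ∑ j, w j * dist (y j) (y' j) := by
  have h1 := hG.variance_le hw hw1 ha a'
  have h2 := hG.variance_le hw hw1 ha' a
  rw [dist_comm a' a] at h2
  -- Adding `h1`, `h2` and this averaged quadrilateral inequality leaves `dist a a' ^ 2` bounded by
  -- `dist a a'` times the average displacement.
  have h3 : ∑ j, w j * dist a' (y j) ^ 2 + ∑ j, w j * dist a (y' j) ^ 2 ≤
      ∑ j, w j * dist a (y j) ^ 2 + ∑ j, w j * dist a' (y' j) ^ 2 +
        2 * dist a a' * ∑ j, w j * dist (y j) (y' j) := by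
    simp only [Finset.mul_sum, ← Finset.sum_add_distrib]
    refine Finset.sum_le_sum fun j _ => ?_
    linarith [mul_le_mul_of_nonneg_left (hG.quadrilateral a a' (y j) (y' j)) (hw j)]
  rcases (dist_nonneg (x := a) (y := a')).eq_or_lt with h | h
  · rw [← h]
    exact Finset.sum_nonneg fun j _ => mul_nonneg (hw j) dist_nonneg
  · refine le_of_mul_le_mul_left (a := 2 * dist a a') ?_ (by linarith)
    linarith

end IsTree

/-! ### Expected costs and strategyproofness. -/

section Expectation

omit [MetricSpace G] in
theorem expect_pure (a : G) (g : G → ℝ) : expect (PMF.pure a) g = ENNReal.ofReal (g a) := by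
  rw [expect, tsum_eq_single a]
  · simp
  · intro b hb
    simp [PMF.pure_apply, hb]

omit [MetricSpace G] in
theorem expect_bind {α : Type*} (p : PMF α) (k : α → PMF G) (g : G → ℝ) :
    expect (p.bind k) g = ∑' a, p a * expect (k a) g := by
  simp only [expect, PMF.bind_apply, ← ENNReal.tsum_mul_right, ← ENNReal.tsum_mul_left]
  rw [ENNReal.tsum_comm]
  simp only [mul_assoc]

variable [Nonempty G] {n m : ℕ}

theorem expect_parameterizedBoomerang (f : Fin m → DetMechanism n G) (w : PMF (Fin m))
    (x : Fin n → G) {g : G → ℝ} (hg : ∀ y, 0 ≤ g y) :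
    expect (parameterizedBoomerang f w x) g = ENNReal.ofReal
      (2⁻¹ * ∑ j, (w j).toReal * g (f j x) + 2⁻¹ * g (wAvg (fun j => f j x) w)) := by
  have h2 : ENNReal.ofReal 2⁻¹ = 2⁻¹ := by
    rw [ENNReal.ofReal_inv_of_pos two_pos, ENNReal.ofReal_ofNat]
  have hs : expect (w.map fun j => f j x) g =
      ENNReal.ofReal (∑ j, (w j).toReal * g (f j x)) := by
    rw [PMF.map, expect_bind, tsum_fintype, ENNReal.ofReal_sum_of_nonneg
      fun j _ => mul_nonneg ENNReal.toReal_nonneg (hg _)]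
    refine Finset.sum_congr rfl fun j _ => ?_
    rw [ENNReal.ofReal_mul ENNReal.toReal_nonneg, ENNReal.ofReal_toReal (w.apply_ne_top j),
      Function.comp_apply, expect_pure]
  have hs0 : 0 ≤ ∑ j, (w j).toReal * g (f j x) :=
    Finset.sum_nonneg fun j _ => mul_nonneg ENNReal.toReal_nonneg (hg _)
  rw [parameterizedBoomerang, expect_bind, tsum_fintype, ENNReal.ofReal_add
    (mul_nonneg (by norm_num) hs0) (mul_nonneg (by norm_num) (hg _)),
    ENNReal.ofReal_mul (by norm_num), ENNReal.ofReal_mul (by norm_num), h2, ← hs]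
  simp [expect_pure]

theorem IsTree.isWAvg_wAvg (hG : IsTree G) [NeZero m] (y : Fin m → G) (w : PMF (Fin m)) :
    IsWAvg y w (wAvg y w) :=
  Classical.epsilon_spec (hG.exists_minimizer (fun _ => ENNReal.toReal_nonneg) y)

omit [MetricSpace G] [Nonempty G] in
theorem sum_toReal_pmf (w : PMF (Fin m)) : ∑ j, (w j).toReal = 1 := by
  rw [← ENNReal.toReal_sum fun j _ => w.apply_ne_top j, ← tsum_fintype (L := .unconditional _),
    w.tsum_coe, ENNReal.toReal_one]

/-- Parameterized boomerang mechanisms are strategyproof. -/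
theorem IsTree.randStrategyproof_parameterizedBoomerang (hG : IsTree G) [NeZero m]
    {f : Fin m → DetMechanism n G} (hf : ∀ j, IsBoomerang (f j)) (w : PMF (Fin m)) :
    RandStrategyproof (parameterizedBoomerang f w) := by
  intro x i x'
  rw [expect_parameterizedBoomerang _ _ _ fun _ => dist_nonneg,
    expect_parameterizedBoomerang _ _ _ fun _ => dist_nonneg]
  apply ENNReal.ofReal_le_ofReal
  have h1 := hG.dist_minimizer_le (w := fun j => (w j).toReal) (fun _ => ENNReal.toReal_nonneg)
    (sum_toReal_pmf w) (hG.isWAvg_wAvg (fun j => f j x) w)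
    (hG.isWAvg_wAvg (fun j => f j (Function.update x i x')) w)
  -- The loss on heads is exactly the bound `h1` for the gain on tails.
  have h2 : ∑ j, (w j).toReal * dist (f j (Function.update x i x')) (x i) =
      ∑ j, (w j).toReal * dist (f j x) (x i) +
        ∑ j, (w j).toReal * dist (f j x) (f j (Function.update x i x')) := by
    rw [← Finset.sum_add_distrib]
    refine Finset.sum_congr rfl fun j _ => ?_
    rw [dist_comm (f j x) (f j _), ← hf j x i x']
    ring
  have h3 := dist_triangle (wAvg (fun j => f j x) w)
    (wAvg (fun j => f j (Function.update x i x')) w) (x i)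
  linarith

end Expectation

/-! ### The lower bound for deterministic mechanisms. -/

section LowerBound

variable {n : ℕ} {f : DetMechanism n G}

/-- A strategyproof mechanism does not react when some agents move to the facility. -/
theorem DetStrategyproof.apply_ite (hf : DetStrategyproof f) (x : Fin n → G) (T : Finset (Fin n)) :
    f (fun j => if j ∈ T then f x else x j) = f x := by
  classical
  induction T using Finset.induction with
  | empty => simp
  | insert i T hi ih =>
    -- Agent `i`, located at `f x`, could report her old location and by induction have cost 0.
    have h := hf (fun j => if j ∈ insert i T then f x else x j) i (x i)
    have h1 : Function.update (fun j => if j ∈ insert i T then f x else x j) i (x i) =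
        fun j => if j ∈ T then f x else x j := by
      funext j
      rcases eq_or_ne j i with rfl | hj
      · simp [hi]
      · simp [hj]
    rw [h1, ih] at h
    simp only [Finset.mem_insert_self, if_true, dist_self] at h
    exact dist_le_zero.1 h

/-- Either endpoint costs `T.card * dist a b ^ 2`, the midpoint half of that. -/
theorem DetApproximates.two_le_of_split (hG : IsTree G) {α : ℝ} (hf : DetApproximates α f)
    {T : Finset (Fin n)} (hT : T.card + T.card = n) (hn : 0 < n) {a b : G} (hab : a ≠ b)
    (h : f (fun j => if j ∈ T then a else b) = a ∨ f (fun j => if j ∈ T then a else b) = b) :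
    2 ≤ α := by
  have hd := dist_pos.2 hab
  have hsum : ∀ y : G, socialCost y (fun j => if j ∈ T then a else b) =
      T.card * (dist y a ^ 2 + dist y b ^ 2) := by
    intro y
    have hc : Tᶜ.card = T.card := by
      rw [Finset.card_compl, Fintype.card_fin]; omega
    rw [socialCost, ← Finset.sum_add_sum_compl T, Finset.sum_congr rfl
      (g := fun _ => dist y a ^ 2) (fun j hj => by simp [hj]), Finset.sum_congr (s₁ := Tᶜ) rfl
      (g := fun _ => dist y b ^ 2) (fun j hj => by simp [Finset.mem_compl.1 hj])]
    simp only [Finset.sum_const, nsmul_eq_mul, hc]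
    ring
  have h1 := hf fun j => if j ∈ T then a else b
  obtain ⟨z, hz, hz'⟩ := hG.exists_mem_path_dist_eq a b (s := dist a b / 2) (by linarith)
    (by linarith)
  have h2 : optCost (fun j => if j ∈ T then a else b) ≤ T.card * (dist a b ^ 2 / 2) := by
    refine (ciInf_le ⟨0, ?_⟩ z).trans_eq ?_
    · rintro _ ⟨y, rfl⟩
      exact Finset.sum_nonneg fun j _ => sq_nonneg _
    · rw [mem_path] at hz
      rw [hsum, dist_comm z a, hz', show dist z b = dist a b / 2 by linarith]
      ring
  have h3 : 0 ≤ optCost (fun j => if j ∈ T then a else b) :=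
    Real.iInf_nonneg fun y => Finset.sum_nonneg fun j _ => sq_nonneg _
  have h4 : socialCost (f fun j => if j ∈ T then a else b) (fun j => if j ∈ T then a else b) =
      T.card * dist a b ^ 2 := by
    rw [hsum]
    rcases h with h | h <;> rw [h] <;> simp [dist_comm]
  have hT0 : (0 : ℝ) < T.card := by
    have : 0 < T.card := by omega
    exact_mod_cast this
  have hpos : 0 < T.card * dist a b ^ 2 := by positivity
  rw [h4] at h1
  have hα : 0 < α := by
    by_contra! hα
    linarith [mul_nonpos_of_nonpos_of_nonneg hα h3]
  have h5 := h1.trans (mul_le_mul_of_nonneg_left h2 hα.le)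
  by_contra! hlt
  nlinarith

theorem two_le_of_detStrategyproof (hG : IsTree G) [Nontrivial G] (he : Even n) (hn : 0 < n)
    (hf : DetStrategyproof f) {α : ℝ} (hα : DetApproximates α f) : 2 ≤ α := by
  obtain ⟨k, hk⟩ := he
  obtain ⟨T, -, hT⟩ := Finset.exists_subset_card_eq (s := (Finset.univ : Finset (Fin n))) (n := k)
    (by simp; omega)
  obtain ⟨a, b, hab⟩ := exists_pair_ne G
  by_cases hp : f (fun j => if j ∈ T then a else b) = b
  · exact hα.two_le_of_split hG (by omega) hn hab (Or.inr hp)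
  -- Move the agents at `a` to the facility: it stays, and is now an endpoint of the split.
  · refine hα.two_le_of_split hG (T := T) (by omega) hn hp (Or.inl ?_)
    have h := hf.apply_ite (fun j => if j ∈ T then a else b) T
    convert h using 2
    funext j
    by_cases hj : j ∈ T <;> simp [hj]

end LowerBound

/-! ### The one-dimensional cost inequality. -/

section Estimate

variable {n : ℕ} {t h : Fin n → ℝ} {μ τ k : ℝ}

/-- The squares of differences of coordinates are expanded exactly around `τ`, which leaves the gain
`-3 * (n * (μ - τ)) ^ 2`; the terms mixed with `h` use the triangle inequality through `τ`. -/
theorem sum_sq_dist_le (hh : ∀ j, 0 ≤ h j) (hμ : n * μ = ∑ j, t j) :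
    ∑ i, ∑ j, (|t i - t j| + h j) ^ 2 + n * ∑ j, (|μ - t j| + h j) ^ 2 ≤
      n * ∑ j, (3 * |τ - t j| ^ 2 + 4 * (|τ - t j| * h j) + 2 * h j ^ 2) +
        2 * (∑ j, |τ - t j|) * ∑ j, h j + (∑ j, h j) ^ 2 / 3 := by
  set u := fun j => |τ - t j| with hu
  have hus : ∀ j, u j ^ 2 = (t j - τ) ^ 2 := fun j => by
    simp only [hu, sq_abs]; ring
  have hs : ∑ j, (t j - τ) = n * (μ - τ) := by
    rw [Finset.sum_sub_distrib, ← hμ]; simp; ring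
  set U := ∑ j, u j
  set H := ∑ j, h j
  have hn0 : (0 : ℝ) ≤ n := n.cast_nonneg
  have hH : 0 ≤ H := Finset.sum_nonneg fun j _ => hh j
  have h1 : ∀ i, ∑ j, (|t i - t j| + h j) ^ 2 ≤ n * u i ^ 2 - 2 * (t i - τ) * (n * (μ - τ)) +
      2 * u i * H + ∑ j, (u j ^ 2 + 2 * (u j * h j) + h j ^ 2) := by
    intro i
    have : ∑ j, (|t i - t j| + h j) ^ 2 ≤ ∑ j, (u i ^ 2 - 2 * (t i - τ) * (t j - τ) +
        2 * u i * h j + (u j ^ 2 + 2 * (u j * h j) + h j ^ 2)) := by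
      refine Finset.sum_le_sum fun j _ => ?_
      have h2 : |t i - t j| ≤ u i + u j := by
        have := abs_sub_le (t i) τ (t j)
        rwa [abs_sub_comm (t i) τ] at this
      have h3 := sq_abs (t i - t j)
      rw [hus, hus]
      nlinarith [mul_le_mul_of_nonneg_right h2 (hh j)]
    refine this.trans_eq ?_
    rw [Finset.sum_add_distrib, Finset.sum_add_distrib, Finset.sum_sub_distrib, ← Finset.mul_sum,
      ← Finset.mul_sum, hs]
    simp [H]
  have h2 : ∑ j, (|μ - t j| + h j) ^ 2 ≤
      ∑ j, (u j ^ 2 + 2 * (u j * h j) + h j ^ 2) - n * (μ - τ) ^ 2 + 2 * |μ - τ| * H := by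
    have : ∑ j, (|μ - t j| + h j) ^ 2 ≤ ∑ j, ((u j ^ 2 + 2 * (u j * h j) + h j ^ 2) +
        (μ - τ) ^ 2 - 2 * (μ - τ) * (t j - τ) + 2 * |μ - τ| * h j) := by
      refine Finset.sum_le_sum fun j _ => ?_
      have h2 : |μ - t j| ≤ |μ - τ| + u j := abs_sub_le μ τ (t j)
      have h3 := sq_abs (μ - t j)
      rw [hus]
      nlinarith [mul_le_mul_of_nonneg_right h2 (hh j)]
    refine this.trans_eq ?_
    rw [Finset.sum_add_distrib, Finset.sum_sub_distrib, Finset.sum_add_distrib, ← Finset.mul_sum,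
      ← Finset.mul_sum, hs]
    simp only [Finset.sum_const, Finset.card_univ, Fintype.card_fin, nsmul_eq_mul, H]
    ring
  have h3 : ∑ i, ∑ j, (|t i - t j| + h j) ^ 2 ≤ n * ∑ i, u i ^ 2 - 2 * (n * (μ - τ)) ^ 2 +
      2 * U * H + n * ∑ j, (u j ^ 2 + 2 * (u j * h j) + h j ^ 2) := by
    refine (Finset.sum_le_sum fun i _ => h1 i).trans_eq ?_
    rw [Finset.sum_add_distrib, Finset.sum_add_distrib, Finset.sum_sub_distrib, ← Finset.mul_sum,
      ← Finset.sum_mul, ← Finset.sum_mul, ← Finset.mul_sum, ← Finset.mul_sum, hs]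
    simp only [Finset.sum_const, Finset.card_univ, Fintype.card_fin, nsmul_eq_mul, U]
    ring
  have h4 : n * ∑ j, (3 * u j ^ 2 + 4 * (u j * h j) + 2 * h j ^ 2) =
      n * ∑ i, u i ^ 2 + 2 * (n * ∑ j, (u j ^ 2 + 2 * (u j * h j) + h j ^ 2)) := by
    simp only [Finset.mul_sum, ← Finset.sum_add_distrib]
    exact Finset.sum_congr rfl fun j _ => by ring
  have h5 := mul_le_mul_of_nonneg_left h2 hn0
  have h6 : (n : ℝ) ^ 2 * |μ - τ| ^ 2 = (n : ℝ) ^ 2 * (μ - τ) ^ 2 := by rw [sq_abs]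
  rw [h4]
  -- The gain absorbs `2 * n * |μ - τ| * H` up to `H ^ 2 / 3`.
  linarith [sq_nonneg (H - 3 * (n * |μ - τ|))]

/-- `S`, `Q` are the sums of distances and of their squares over `B`, and `W`, `P` those over the
other agents. -/
theorem estimate_aux {N P Q S W U H k E : ℝ} (hN : 0 ≤ N) (hW0 : 0 ≤ W) (hk : 0 ≤ k)
    (hQ : 3 * S ^ 2 ≤ N * Q) (hP : W ^ 2 ≤ N * P) (hPQ : (S + W) ^ 2 ≤ N * (P + Q))
    (hH : U + H = S + W) (hE : P + Q + 2 * k * (W - S) + N * k ^ 2 ≤ E) :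
    N * (3 * P + 2 * Q) + 2 * U * H + H ^ 2 / 3 ≤ 2 * 1.83 * (N * E) := by
  have h1 : 2 * U * H + H ^ 2 / 3 ≤ 0.6 * (S + W) ^ 2 := by
    rw [← hH]
    -- The two sides differ by `(3 * U - 2 * H) ^ 2 / 15`.
    nlinarith [sq_nonneg (3 * U - 2 * H)]
  have h2 := mul_le_mul_of_nonneg_left hE hN
  have h0 : 0 ≤ N * Q := by nlinarith [sq_nonneg S]
  rcases le_total S W with h | h
  -- Here leaving the path does not help, and `hPQ` gives the factor `3.6`.
  · have h3 : 0 ≤ N * (2 * k * (W - S) + N * k ^ 2) :=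
      mul_nonneg hN (add_nonneg (mul_nonneg (by linarith) (by linarith)) (by positivity))
    nlinarith [sq_nonneg W]
  -- The best `k` has `N * k = S - W`; the resulting loss `(S - W) ^ 2` is paid for by `hQ`, that
  -- is, by `B` being small.
  · nlinarith [sq_nonneg (N * k - (S - W)), mul_nonneg hW0 (sub_nonneg.2 h)]

/-- `v j` is the distance of agent `j` from a point at distance `k` off the path, with projection at
`τ`; `B` consists of the agents on its side. Agents in `B` have `t j = τ`, which lowers their
coefficient from 3 to 2. -/
theorem estimate {v : Fin n → ℝ} {B : Finset (Fin n)} (hh : ∀ j, 0 ≤ h j)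
    (hμ : n * μ = ∑ j, t j) (hk : 0 ≤ k) (hB : 3 * (B.card : ℝ) ≤ n)
    (htB : ∀ j ∈ B, t j = τ) (hvB : ∀ j ∈ B, (h j - k) ^ 2 ≤ v j ^ 2)
    (hv : ∀ j ∉ B, v j = k + (|τ - t j| + h j)) :
    ∑ i, ∑ j, (|t i - t j| + h j) ^ 2 + n * ∑ j, (|μ - t j| + h j) ^ 2 ≤
      2 * 1.83 * (n * ∑ j, v j ^ 2) := by
  refine (sum_sq_dist_le (τ := τ) hh hμ).trans ?_
  have hn0 : (0 : ℝ) ≤ n := n.cast_nonneg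
  have hu0 : ∀ j ∈ B, |τ - t j| = 0 := fun j hj => by rw [htB j hj, sub_self, abs_zero]
  set w := fun j => |τ - t j| + h j with hw
  have hw0 : ∀ j, 0 ≤ w j := fun j => add_nonneg (abs_nonneg _) (hh j)
  have hwB : ∀ j ∈ B, w j = h j := fun j hj => by simp only [hw, hu0 j hj, zero_add]
  have hsplit : ∀ g : Fin n → ℝ, ∑ j, g j = ∑ j ∈ Bᶜ, g j + ∑ j ∈ B, g j := fun g =>
    (Finset.sum_compl_add_sum B g).symm
  have hcard : (Bᶜ.card : ℝ) = n - B.card := by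
    rw [Finset.card_compl, Fintype.card_fin, Nat.cast_sub (by simpa using B.card_le_univ)]
  have h1 : ∑ j, (3 * |τ - t j| ^ 2 + 4 * (|τ - t j| * h j) + 2 * h j ^ 2) ≤
      3 * ∑ j ∈ Bᶜ, w j ^ 2 + 2 * ∑ j ∈ B, w j ^ 2 := by
    rw [hsplit, Finset.mul_sum, Finset.mul_sum]
    refine add_le_add (Finset.sum_le_sum fun j _ => ?_) (Finset.sum_le_sum fun j hj => ?_)
    · have := abs_nonneg (τ - t j)
      nlinarith [mul_nonneg this (hh j), sq_nonneg (h j)]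
    · rw [hwB j hj, hu0 j hj]
      linarith
  have hS : (∑ j ∈ B, w j) ^ 2 ≤ B.card * ∑ j ∈ B, w j ^ 2 := sq_sum_le_card_mul_sum_sq
  have hW : (∑ j ∈ Bᶜ, w j) ^ 2 ≤ Bᶜ.card * ∑ j ∈ Bᶜ, w j ^ 2 := sq_sum_le_card_mul_sum_sq
  have hT : (∑ j, w j) ^ 2 ≤ (Finset.univ : Finset (Fin n)).card * ∑ j, w j ^ 2 :=
    sq_sum_le_card_mul_sum_sq
  rw [Finset.card_univ, Fintype.card_fin, hsplit, hsplit, add_comm (∑ j ∈ Bᶜ, w j)] at hT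
  have hQ0 : 0 ≤ ∑ j ∈ B, w j ^ 2 := Finset.sum_nonneg fun j _ => sq_nonneg _
  have hP0 : 0 ≤ ∑ j ∈ Bᶜ, w j ^ 2 := Finset.sum_nonneg fun j _ => sq_nonneg _
  have hE : ∑ j ∈ Bᶜ, w j ^ 2 + ∑ j ∈ B, w j ^ 2 +
      2 * k * (∑ j ∈ Bᶜ, w j - ∑ j ∈ B, w j) + n * k ^ 2 ≤ ∑ j, v j ^ 2 := by
    have e1 : ∑ j ∈ Bᶜ, (k + w j) ^ 2 ≤ ∑ j ∈ Bᶜ, v j ^ 2 :=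
      Finset.sum_le_sum fun j hj => by rw [hv j (Finset.mem_compl.1 hj)]
    have e2 : ∑ j ∈ B, (w j - k) ^ 2 ≤ ∑ j ∈ B, v j ^ 2 :=
      Finset.sum_le_sum fun j hj => by rw [hwB j hj]; exact hvB j hj
    have e3 : ∑ j ∈ Bᶜ, (k + w j) ^ 2 =
        (n - B.card) * k ^ 2 + 2 * k * ∑ j ∈ Bᶜ, w j + ∑ j ∈ Bᶜ, w j ^ 2 := by
      simp only [add_sq, Finset.sum_add_distrib, Finset.mul_sum, Finset.sum_const, nsmul_eq_mul,
        hcard]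
    have e4 : ∑ j ∈ B, (w j - k) ^ 2 =
        ∑ j ∈ B, w j ^ 2 - 2 * k * ∑ j ∈ B, w j + B.card * k ^ 2 := by
      simp only [sub_sq, Finset.sum_add_distrib, Finset.sum_sub_distrib, Finset.mul_sum,
        Finset.sum_const, nsmul_eq_mul]
      congr 2
      exact Finset.sum_congr rfl fun j _ => by ring
    rw [hsplit (fun j => v j ^ 2)]
    linarith
  have hUH : ∑ j, |τ - t j| + ∑ j, h j = ∑ j ∈ B, w j + ∑ j ∈ Bᶜ, w j := by
    rw [add_comm (∑ j ∈ B, w j), ← hsplit, ← Finset.sum_add_distrib]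
  have h2 := estimate_aux hn0 (Finset.sum_nonneg fun j _ => hw0 j) hk (by nlinarith)
    (hW.trans (by rw [hcard]; gcongr; linarith [(Nat.cast_nonneg B.card : (0 : ℝ) ≤ _)]))
    hT hUH hE
  refine le_trans ?_ h2
  gcongr

end Estimate

/-! ### Stopping points on a path and the approximation ratio. -/

theorem lt_ncard_of_not_isHeavy {n : ℕ} {q : ℝ} {x : Fin n → G} {a z : G}
    (h : ¬ IsHeavy q x a z) : (1 - q) * n < ({j | a ∈ path z (x j)}.ncard : ℝ) := by
  have h1 := Set.ncard_add_ncard_compl {j : Fin n | a ∈ path z (x j)}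
  rw [Nat.card_eq_fintype_card, Fintype.card_fin] at h1
  have h2 : (({j : Fin n | x j ∈ branch a z}.ncard : ℕ) : ℝ) < q * n := not_le.1 h
  have h3 : ({j | a ∈ path z (x j)}.ncard : ℝ) +
      ({j : Fin n | x j ∈ branch a z}.ncard : ℕ) = n := by exact_mod_cast h1
  linarith

theorem disjoint_of_mem_path {ι : Type*} {x : ι → G} (hG : IsTree G) {m p p' : G}
    (h : m ∈ path p p') (hp : m ≠ p) (hp' : m ≠ p') :
    Disjoint {j | p ∈ path m (x j)} {j | p' ∈ path m (x j)} := by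
  refine Set.disjoint_left.2 fun j h1 h2 => ?_
  rcases hG.mem_path_or h1 h2 with h3 | h3
  · rw [path_comm] at h h3
    refine hp' (eq_of_mem_path_of_mem_path (a := p) ?_ h3)
    rwa [path_comm]
  · rw [path_comm] at h3
    refine hp (eq_of_mem_path_of_mem_path (a := p') ?_ h3)
    rwa [path_comm]

namespace IsTree

variable (hG : IsTree G) {n : ℕ} {q : ℝ} {x y : Fin n → G}
include hG

/-- Three central points lie on a path, if `q` is at most `2 / 3`. -/
theorem median_eq_of_central (hq : q ≤ 2 / 3) {m a b c : G} (h1 : m ∈ path a b)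
    (h2 : m ∈ path a c) (h3 : m ∈ path b c) (ha : ∀ z, z ≠ a → ¬ IsHeavy q x a z)
    (hb : ∀ z, z ≠ b → ¬ IsHeavy q x b z) (hc : ∀ z, z ≠ c → ¬ IsHeavy q x c z) :
    m = a ∨ m = b ∨ m = c := by
  by_contra! h
  obtain ⟨na, nb, nc⟩ := h
  have d1 := disjoint_of_mem_path (x := x) hG h1 na nb
  have d2 := disjoint_of_mem_path (x := x) hG h2 na nc
  have d3 := disjoint_of_mem_path (x := x) hG h3 nb nc
  have e1 := lt_ncard_of_not_isHeavy (ha m na)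
  have e2 := lt_ncard_of_not_isHeavy (hb m nb)
  have e3 := lt_ncard_of_not_isHeavy (hc m nc)
  have c1 := Set.ncard_union_eq d1 (Set.toFinite _) (Set.toFinite _)
  have c2 := Set.ncard_union_eq (Set.disjoint_union_left.2 ⟨d2, d3⟩) (Set.toFinite _)
    (Set.toFinite _)
  have c3 := Set.ncard_le_card ({j | a ∈ path m (x j)} ∪ {j | b ∈ path m (x j)} ∪
    {j | c ∈ path m (x j)})
  rw [Nat.card_eq_fintype_card, Fintype.card_fin, c2, c1] at c3
  have c4 : ({j | a ∈ path m (x j)}.ncard : ℝ) + {j | b ∈ path m (x j)}.ncard +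
    {j | c ∈ path m (x j)}.ncard ≤ n := by exact_mod_cast c3
  have : (0 : ℝ) ≤ n := n.cast_nonneg
  nlinarith

variable (hy : ∀ j, IsStop q x (x j) (y j))
include hy

/-- Otherwise the walk of `j` leaves the path between the stops through a heavy branch that does not
contain `y i`, so `y i` would not be a stop. -/
theorem stop_mem_path_stop (i j : Fin n) : y j ∈ path (x j) (y i) := by
  by_contra h
  obtain ⟨m, m1, m2, m3⟩ := hG.exists_median (x j) (y j) (y i)
  have hm : m ≠ y j := by rintro rfl; exact h m2
  exact not_isHeavy_of_central (hy i).2 m3 hm ((hy j).1 m m1 hm)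

/-- If `q` is at most `2 / 3`, the stopping points of the agents lie on a path. -/
theorem exists_stops_on_path (hq : q ≤ 2 / 3) [NeZero n] :
    ∃ i j, ∀ k, y k ∈ path (y i) (y j) := by
  -- Two stops at maximal distance are the ends: no third stop can lie beyond them.
  obtain ⟨⟨i, j⟩, -, hmax⟩ := (Finset.univ : Finset (Fin n × Fin n)).exists_max_image
    (fun p => dist (y p.1) (y p.2)) ⟨(0, 0), Finset.mem_univ _⟩
  refine ⟨i, j, fun k => ?_⟩
  obtain ⟨m, m1, m2, m3⟩ := hG.exists_median (y i) (y j) (y k)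
  rcases hG.median_eq_of_central hq m1 m2 m3 (hy i).2 (hy j).2 (hy k).2 with rfl | rfl | rfl
  · have h := hmax (j, k) (Finset.mem_univ _)
    rw [mem_path, dist_comm (y j)] at m3
    simp only at h
    have : y i = y k := dist_le_zero.1 (by linarith)
    rw [← this]
    exact m1
  · have h := hmax (i, k) (Finset.mem_univ _)
    rw [mem_path] at m2
    simp only at h
    have : y j = y k := dist_le_zero.1 (by linarith)
    rw [← this]
    exact m1
  · exact m1

variable {L R : G} (hL : L ∈ Set.range y) (hR : R ∈ Set.range y) (hLR : ∀ k, y k ∈ path L R)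
include hL hR hLR

theorem stop_mem_path {z : G} (hz : z ∈ path L R) (j : Fin n) : y j ∈ path (x j) z := by
  obtain ⟨i, rfl⟩ := hL
  obtain ⟨i', rfl⟩ := hR
  rcases hG.mem_path_or' (hLR j) hz with h | h
  · rw [path_comm] at h
    exact mem_path_of_mem_of_mem_right (hG.stop_mem_path_stop hy i j) h
  · exact mem_path_of_mem_of_mem_right (hG.stop_mem_path_stop hy i' j) h

/-- This reduces costs on the path to the coordinates `dist L (y j)` and the heights `dist (x j) (y
j)`. -/
theorem dist_of_mem_path {z : G} (hz : z ∈ path L R) (j : Fin n) :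
    dist z (x j) = |dist L z - dist L (y j)| + dist (x j) (y j) := by
  have h := hG.stop_mem_path hy hL hR hLR hz j
  rw [mem_path] at h
  rw [← hG.dist_eq_of_mem_path hz (hLR j), dist_comm z, dist_comm z]
  linarith

/-- A branch that leaves the path of stopping points contains few agents, and they all stop at its
root. -/
theorem stop_eq_and_card_le (hq : q ≤ 1) {e o : G} (he : e ∈ path L R)
    (ho : ∀ z ∈ path L R, e ∈ path o z) {B : Finset (Fin n)}
    (hB : ∀ k, k ∈ B ↔ e ∉ path o (x k)) : (∀ k ∈ B, y k = e) ∧ q * n + B.card ≤ n := by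
  have hBe : ∀ k ∈ B, y k = e := by
    intro k hk
    have h1 := hG.stop_mem_path hy hL hR hLR he k
    have h2 : e ∈ path (x k) (y k) := by
      by_contra h
      exact hG.notMem_path_trans ((hB k).1 hk) h (ho _ (hLR k))
    exact eq_of_mem_path_of_mem_path h1 h2
  refine ⟨hBe, ?_⟩
  rcases B.eq_empty_or_nonempty with rfl | ⟨j, hj⟩
  · have : (0 : ℝ) ≤ n := n.cast_nonneg
    simp only [Finset.card_empty, Nat.cast_zero]
    nlinarith
  -- The walk of `j` passes `c` on its way to `e`, so the branch at `c` towards `e` is heavy, while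
  -- all of `B` lies behind `c`.
  obtain ⟨c, hce, hc, -⟩ := hG.exists_common_start x hj (e := e) fun k hk =>
    hG.notMem_path_trans (by rw [path_comm]; exact (hB j).1 hj) ((hB k).1 hk)
  have h1 : c ∈ path (x j) (y j) := by
    rw [hBe j hj, path_comm]
    exact hc j hj
  have h2 := (hy j).1 c h1 (by rw [hBe j hj]; exact hce)
  rw [hBe j hj] at h2
  simpa using h2.add_ncard_le (s := (B : Set (Fin n))) fun k hk => hc k hk

/-- The expected social cost of the stopping points and their mean. -/
theorem sum_socialCost_le (hq : q = 2 / 3) {a : G} (ha : a ∈ path L R)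
    (ha' : n * dist L a = ∑ j, dist L (y j)) (o : G) :
    ∑ i, socialCost (y i) x + n * socialCost a x ≤ 2 * 1.83 * (n * socialCost o x) := by
  classical
  -- `e` is the projection of `o` to the path.
  obtain ⟨e, e1, e2, e3⟩ := hG.exists_median L R o
  have ho : ∀ z ∈ path L R, e ∈ path o z := by
    intro z hz
    rw [path_comm] at e2 e3
    rcases hG.mem_path_or' e1 hz with h | h
    · rw [path_comm] at h
      exact mem_path_of_mem_of_mem_right e2 h
    · exact mem_path_of_mem_of_mem_right e3 h
  let B : Finset (Fin n) := {k | e ∉ path o (x k)}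
  have hB : ∀ k, k ∈ B ↔ e ∉ path o (x k) := by simp [B]
  obtain ⟨hBe, hcard⟩ := hG.stop_eq_and_card_le hy hL hR hLR (by linarith) e1 ho hB
  have key := estimate (t := fun j => dist L (y j)) (h := fun j => dist (x j) (y j))
    (μ := dist L a) (τ := dist L e) (k := dist o e) (v := fun j => dist o (x j)) (B := B)
    (fun j => dist_nonneg) ha' dist_nonneg (by rw [hq] at hcard; linarith)
    (fun j hj => by rw [hBe j hj])
    (fun j hj => by
      rw [hBe j hj, sq_le_sq, abs_of_nonneg (dist_nonneg (x := o)), dist_comm o (x j)]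
      exact abs_dist_sub_le (x j) o e)
    (fun j hj => by
      have h : e ∈ path o (x j) := by
        by_contra h
        exact hj ((hB j).2 h)
      rw [← hG.dist_of_mem_path hy hL hR hLR e1 j]
      exact h.symm)
  simp only [socialCost]
  simp only [fun i j => hG.dist_of_mem_path hy hL hR hLR (hLR i) j,
    hG.dist_of_mem_path hy hL hR hLR ha]
  exact key

omit hy hL hR in
/-- The mean of points on a path is their average location on the path. -/
theorem isWAvg_uniform_mem_path [NeZero n] {a : G}
    (ha : IsWAvg y (PMF.uniformOfFintype (Fin n)) a) :
    a ∈ path L R ∧ n * dist L a = ∑ j, dist L (y j) := by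
  have hn : (0 : ℝ) < n := Nat.cast_pos.2 (NeZero.pos n)
  set μ := (∑ j, dist L (y j)) / n with hμ
  have hμ' : n * μ = ∑ j, dist L (y j) := mul_div_cancel₀ _ hn.ne'
  obtain ⟨z, hz, hzμ⟩ := hG.exists_mem_path_dist_eq L R (s := μ)
    (div_nonneg (Finset.sum_nonneg fun j _ => dist_nonneg) hn.le) (by
      rw [hμ, div_le_iff₀ hn]
      calc ∑ j, dist L (y j) ≤ ∑ _j : Fin n, dist L R := Finset.sum_le_sum fun j _ => by
            have h := hLR j
            rw [mem_path] at h
            linarith [dist_nonneg (x := y j) (y := R)]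
        _ = dist L R * n := by simp [mul_comm])
  have h1 := hG.variance_le (w := fun j => (PMF.uniformOfFintype (Fin n) j).toReal)
    (fun _ => ENNReal.toReal_nonneg) (sum_toReal_pmf _) ha z
  have hw : ∀ j, (PMF.uniformOfFintype (Fin n) j).toReal = (n : ℝ)⁻¹ := fun j => by
    simp [PMF.uniformOfFintype_apply]
  simp only [hw, ← Finset.mul_sum] at h1
  -- The coordinate `dist L` is 1-Lipschitz on `G`, so no point beats the one with the mean
  -- coordinate; `h1` then forces `a = z`.
  have h2 : ∑ j, dist z (y j) ^ 2 ≤ ∑ j, dist a (y j) ^ 2 :=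
    calc ∑ j, dist z (y j) ^ 2 = ∑ j, (μ - dist L (y j)) ^ 2 :=
          Finset.sum_congr rfl fun j _ => by
            rw [hG.dist_eq_of_mem_path hz (hLR j), sq_abs, hzμ]
      _ = ∑ j, ((dist L a - dist L (y j)) ^ 2 - (dist L a ^ 2 - μ ^ 2) +
            2 * (dist L a - μ) * dist L (y j)) := Finset.sum_congr rfl fun j _ => by ring
      _ = ∑ j, (dist L a - dist L (y j)) ^ 2 - n * (dist L a - μ) ^ 2 := by
          rw [Finset.sum_add_distrib, Finset.sum_sub_distrib, ← Finset.mul_sum, ← hμ']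
          simp only [Finset.sum_const, Finset.card_univ, Fintype.card_fin, nsmul_eq_mul]
          ring
      _ ≤ ∑ j, (dist L a - dist L (y j)) ^ 2 := by
          linarith [mul_nonneg hn.le (sq_nonneg (dist L a - μ))]
      _ ≤ ∑ j, dist a (y j) ^ 2 := Finset.sum_le_sum fun j _ => by
          rw [sq_le_sq, abs_of_nonneg (dist_nonneg (x := a)), dist_comm L a, dist_comm L (y j)]
          exact abs_dist_sub_le a (y j) L
  have h3 := mul_le_mul_of_nonneg_left h2 (inv_nonneg.2 hn.le)
  have h4 : dist a z ^ 2 = 0 := le_antisymm (by linarith) (sq_nonneg _)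
  have h5 : a = z := dist_eq_zero.1 (pow_eq_zero_iff two_ne_zero |>.1 h4)
  rw [h5, hzμ]
  exact ⟨hz, hμ'⟩

omit hy hL hR hLR in
theorem randApproximates_randomizedDGM [Nonempty G] [NeZero n] :
    RandApproximates 1.83 (randomizedDGM n (2 / 3) : RandMechanism n G) := by
  intro x
  have hn : (0 : ℝ) < n := Nat.cast_pos.2 (NeZero.pos n)
  have hsc : ∀ y : G, 0 ≤ socialCost y x := fun y => Finset.sum_nonneg fun j _ => sq_nonneg _
  rw [randomizedDGM, expect_parameterizedBoomerang _ _ _ hsc]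
  apply ENNReal.ofReal_le_ofReal
  have hy : ∀ i, IsStop (2 / 3) x (x i) (dgm (2 / 3) i x) := fun i =>
    hG.isStop_dgm (by norm_num) (NeZero.pos n) x i
  obtain ⟨i, j, hij⟩ := hG.exists_stops_on_path hy le_rfl
  obtain ⟨ha, ha'⟩ := hG.isWAvg_uniform_mem_path hij (hG.isWAvg_wAvg _ _)
  have hw : ∀ j, (PMF.uniformOfFintype (Fin n) j).toReal = (n : ℝ)⁻¹ := fun j => by
    simp [PMF.uniformOfFintype_apply]
  simp only [hw, ← Finset.mul_sum]
  rw [mul_comm 1.83, ← div_le_iff₀ (by norm_num)]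
  refine le_ciInf fun o => ?_
  have h := hG.sum_socialCost_le hy ⟨i, rfl⟩ ⟨j, rfl⟩ hij rfl ha ha' o
  rw [div_le_iff₀ (by norm_num)]
  refine le_of_mul_le_mul_left (a := 2 * (n : ℝ)) ?_ (by linarith)
  calc _ = n * (n : ℝ)⁻¹ * ∑ i, socialCost (dgm (2 / 3) i x) x +
        n * socialCost (wAvg (fun i => dgm (2 / 3) i x) (PMF.uniformOfFintype (Fin n))) x := by
        ring
    _ ≤ 2 * 1.83 * (n * socialCost o x) := by rwa [mul_inv_cancel₀ hn.ne', one_mul]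
    _ = _ := by ring

end IsTree

end FacilityLocation

theorem mainTheorem2 {G : Type*} [MetricSpace G] [Nonempty G] (hG : IsTree G) :
    (∀ (n : ℕ) [NeZero n],
      (∀ i : Fin n, IsBoomerang (dgm (2 / 3) i : DetMechanism n G)) ∧
      RandStrategyproof (randomizedDGM n (2 / 3) : RandMechanism n G) ∧
      RandApproximates 1.83 (randomizedDGM n (2 / 3) : RandMechanism n G)) ∧
    (Nontrivial G → ∀ n : ℕ, Even n → 0 < n → ∀ f : DetMechanism n G, DetStrategyproof f →
      ∀ α : ℝ, DetApproximates α f → 2 ≤ α) := by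
  refine ⟨fun n _ => ?_, fun _ n he hn f hf α hα => two_le_of_detStrategyproof hG he hn hf hα⟩
  have hb : ∀ i : Fin n, IsBoomerang (dgm (2 / 3) i : DetMechanism n G) := fun i =>
    hG.isBoomerang_dgm (by norm_num) (NeZero.pos n) i
  exact ⟨hb, hG.randStrategyproof_parameterizedBoomerang hb _, hG.randApproximates_randomizedDGM⟩
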